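/- For $a\in\mathbb R$ and $n\ge 0$ let $k^{-a}(n)$ denote the $n$-th Taylor coefficient at the origin of the function $(1-t)^a$. Let $H$ be a complex Hilbert space and $T$ a bounded linear operator on $H$. For $a>0$, $T$ is called an \emph{$a$-contraction} if the series $\sum_{n=0}^\infty k^{-a}(n)\,T^{*n}T^n$ converges in the strong operator topology (SOT) of $L(H)$ and its sum is a positive semidefinite operator. \textbf{Theorem.} Let $0<b<a$, where $b$ is not an integer. If $T$ is an $a$-contraction and the series $\sum_{n=0}^\infty |k^{-b}(n)|\,T^{*n}T^n$ converges in SOT, then $T$ is a $b$-contraction. -/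

import Mathlib

open Filter Topology
open scoped Nat

noncomputable section

/-- The Cesàro number `k^a(n)`: the `n`-th Taylor coefficient at the origin of `(1 - t)^(-a)`.
Thus `cesaroNumber (-a) n` is the `n`-th Taylor coefficient of `(1 - t)^a`. -/
def cesaroNumber (a : ℝ) (n : ℕ) : ℝ :=
  iteratedDeriv n (fun t : ℝ => (1 - t) ^ (-a)) 0 / (n ! : ℝ)

section Hereditary

variable {H : Type*} [NormedAddCommGroup H] [InnerProductSpace ℂ H] [CompleteSpace H]

/-- The partial sum `∑_{n < N} α_n T^{*n} T^n`. -/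
def hereditaryPartialSum (α : ℕ → ℝ) (T : H →L[ℂ] H) (N : ℕ) : H →L[ℂ] H :=
  ∑ n ∈ Finset.range N, (α n : ℂ) • (ContinuousLinearMap.adjoint T ^ n * T ^ n)

/-- The series `∑ α_n T^{*n} T^n` converges to `S` in the strong operator topology, which is the
topology of `H →Lₚₜ[ℂ] H` (pointwise convergence of bounded operators). -/
def HasHereditarySum (α : ℕ → ℝ) (T S : H →L[ℂ] H) : Prop :=
  Tendsto
    (fun N => ContinuousLinearMap.toPointwiseConvergenceCLM ℂ (RingHom.id ℂ) H H
      (hereditaryPartialSum α T N))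
    atTop (𝓝 (ContinuousLinearMap.toPointwiseConvergenceCLM ℂ (RingHom.id ℂ) H H S))

/-- The series `∑ |α_n| T^{*n} T^n` converges in the strong operator topology of `L(H)`. -/
def AbsHereditarySummable (α : ℕ → ℝ) (T : H →L[ℂ] H) : Prop :=
  ∃ S : H →L[ℂ] H, HasHereditarySum (fun n => |α n|) T S

/-- `T` is an `a`-contraction: the series `∑ k^{-a}(n) T^{*n} T^n` converges in the strong
operator topology and its sum `(1 - t)^a(T^*, T)` is a positive (semidefinite) operator. -/
def IsRealContraction (a : ℝ) (T : H →L[ℂ] H) : Prop :=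
  ∃ S : H →L[ℂ] H, HasHereditarySum (cesaroNumber (-a)) T S ∧ S.IsPositive

end Hereditary

end

/-!
Put `u n = ‖T ^ n x‖ ^ 2`. Positivity of the `a`-sum at the vectors `T ^ j x` says that all the
fractional differences `∑ n, k^{-a}(n) u (n + j)` are nonnegative, and the goal is
`∑ n, k^{-b}(n) u n ≥ 0`. Formally, `(1 - t)^b = (1 - t)^a (1 - t)^(-(a - b))`, where the second
factor has nonnegative coefficients, so the latter sum is a nonnegative combination of the former
ones. As this rearrangement need not converge absolutely, the second factor is replaced by
`(1 - r t)^(-(a - b))` with `r < 1`, and then `r → 1`.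

The passage to the limit rests on a bound of the `n`-th coefficient of `(1 - t)^(-p) (1 - r t)^(-q)`
by a multiple of `|k^{p + q}(n)|`, uniformly in `r`. If `p + q ≥ 1`, the numbers `k^{p + q}(n)`
increase with `n`, and powers of `(1 - t) / (1 - r t)`, whose coefficients have absolute sum at most
`2`, reduce the bound to the trivial case `p ≥ 0`. Smaller values of `p + q` follow by
differentiating in `t`, as `(n + 1) k^s(n + 1) = s k^{s + 1}(n)`.

The sum of the `b`-series exists because the sign of `k^{-b}(n)` is eventually constant.
-/

section CesaroNumbers

theorem cesaroNumber_eq_ascPochhammer (s : ℝ) (n : ℕ) :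
    cesaroNumber s n = (ascPochhammer ℝ n).eval s / n ! := by
  have hderiv := congrFun
    (iteratedDeriv_comp_const_sub (n := n) (f := fun t : ℝ => t ^ (-s)) (s := 1)) 0
  rw [cesaroNumber, hderiv, sub_zero, iteratedDeriv_eq_iterate, Real.iter_deriv_rpow_const,
    Real.one_rpow, mul_one, smul_eq_mul, ← ascPochhammer_eval_neg_eq_descPochhammer, neg_neg]

theorem cesaroNumber_eq_multichoose (s : ℝ) (n : ℕ) :
    cesaroNumber s n = Ring.multichoose s n := by
  rw [cesaroNumber_eq_ascPochhammer, ← Polynomial.ascPochhammer_smeval_eq_eval,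
    ← Ring.factorial_nsmul_multichoose_eq_ascPochhammer, nsmul_eq_mul,
    mul_div_cancel_left₀ _ (by positivity)]

theorem cesaroNumber_neg_eq_choose (s : ℝ) (n : ℕ) :
    cesaroNumber (-s) n = (-1) ^ n * Ring.choose s n := by
  have h := Ring.choose_neg' (-s) n
  rw [neg_neg] at h
  rw [h, cesaroNumber_eq_multichoose, Units.smul_def, Int.coe_negOnePow_natCast, zsmul_eq_mul]
  push_cast
  rw [← mul_assoc, ← mul_pow]
  simp

@[simp]
theorem cesaroNumber_zero_right (s : ℝ) : cesaroNumber s 0 = 1 := by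
  rw [cesaroNumber_eq_multichoose, Ring.multichoose_zero_right]

@[simp]
theorem cesaroNumber_one_left (n : ℕ) : cesaroNumber 1 n = 1 := by
  rw [cesaroNumber_eq_multichoose, Ring.multichoose_one]

theorem succ_mul_cesaroNumber_succ (s : ℝ) (n : ℕ) :
    (n + 1) * cesaroNumber s (n + 1) = (s + n) * cesaroNumber s n := by
  simp only [cesaroNumber_eq_ascPochhammer, ascPochhammer_succ_eval, Nat.factorial_succ]
  push_cast
  field_simp

theorem succ_mul_cesaroNumber_succ_eq_mul_add_one (s : ℝ) (n : ℕ) :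
    (n + 1) * cesaroNumber s (n + 1) = s * cesaroNumber (s + 1) n := by
  simp only [cesaroNumber_eq_ascPochhammer, ascPochhammer_succ_left, Nat.factorial_succ,
    Polynomial.eval_mul, Polynomial.eval_comp, Polynomial.eval_add, Polynomial.eval_X,
    Polynomial.eval_one]
  push_cast
  field_simp

theorem cesaroNumber_succ (s : ℝ) (n : ℕ) :
    cesaroNumber s (n + 1) = (s + n) / (n + 1) * cesaroNumber s n := by
  rw [div_mul_eq_mul_div, ← succ_mul_cesaroNumber_succ, mul_div_cancel_left₀ _ (by positivity)]

theorem cesaroNumber_nonneg {s : ℝ} (hs : 0 ≤ s) (n : ℕ) : 0 ≤ cesaroNumber s n := by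
  induction n with
  | zero => simp
  | succ n ih => rw [cesaroNumber_succ]; positivity

theorem cesaroNumber_ne_zero {s : ℝ} (hs : ∀ m : ℕ, s ≠ -m) (n : ℕ) : cesaroNumber s n ≠ 0 := by
  induction n with
  | zero => simp
  | succ n ih =>
    have hsn : s + n ≠ 0 := fun h => hs n (eq_neg_of_add_eq_zero_left h)
    rw [cesaroNumber_succ]
    positivity

theorem monotone_cesaroNumber {s : ℝ} (hs : 1 ≤ s) : Monotone (cesaroNumber s) := by
  refine monotone_nat_of_le_succ fun n => ?_
  rw [cesaroNumber_succ]
  refine le_mul_of_one_le_left (cesaroNumber_nonneg (by linarith) n) ?_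
  rw [one_le_div (by positivity)]
  linarith

theorem exists_eventually_cesaroNumber_eq_mul_abs (s : ℝ) :
    ∃ σ : ℝ, ∀ᶠ n in atTop, cesaroNumber s n = σ * |cesaroNumber s n| := by
  obtain ⟨N, hN⟩ := exists_nat_ge (-s)
  refine ⟨SignType.sign (cesaroNumber s N), eventually_atTop.2 ⟨N, fun n hn => ?_⟩⟩
  induction n, hn using Nat.le_induction with
  | base => exact (sign_mul_abs _).symm
  | succ n hn ih =>
    have hratio : 0 ≤ (s + n) / (n + 1 : ℝ) := by
      have : (N : ℝ) ≤ n := by exact_mod_cast hn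
      exact div_nonneg (by linarith) (by positivity)
    rw [cesaroNumber_succ, abs_mul, abs_of_nonneg hratio, mul_left_comm, ← ih]

theorem tendsto_cesaroNumber_ratio (s : ℝ) :
    Tendsto (fun n : ℕ => (s + n) / (n + 1 : ℝ)) atTop (𝓝 1) := by
  simpa [add_comm (1 : ℝ)] using tendsto_add_mul_div_add_mul_atTop_nhds s 1 1 (one_ne_zero' ℝ)

theorem summable_cesaroNumber_mul_pow (s : ℝ) {x : ℝ} (hx : |x| < 1) :
    Summable fun n => cesaroNumber s n * x ^ n := by
  obtain ⟨y, hxy, hy⟩ := exists_between hx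
  refine summable_of_ratio_norm_eventually_le hy ?_
  have hlim := ((tendsto_cesaroNumber_ratio s).mul_const x).abs
  rw [one_mul] at hlim
  filter_upwards [hlim.eventually_le_const hxy] with n hn
  calc ‖cesaroNumber s (n + 1) * x ^ (n + 1)‖
      = |(s + n) / (n + 1) * x| * ‖cesaroNumber s n * x ^ n‖ := by
        rw [cesaroNumber_succ, Real.norm_eq_abs, Real.norm_eq_abs, ← abs_mul]
        ring_nf
    _ ≤ y * ‖cesaroNumber s n * x ^ n‖ := by gcongr

theorem eventually_mul_abs_cesaroNumber_le_succ (s : ℝ) {ρ : ℝ} (hρ : ρ < 1) :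
    ∀ᶠ n in atTop, ρ * |cesaroNumber s n| ≤ |cesaroNumber s (n + 1)| := by
  filter_upwards [(tendsto_cesaroNumber_ratio s).eventually_const_le hρ] with n hn
  rw [cesaroNumber_succ, abs_mul]
  gcongr
  exact hn.trans (le_abs_self _)

theorem exists_forall_le_mul_of_monotoneOn {d : ℕ → ℝ} (hd : ∀ n, 0 < d n) {N : ℕ}
    (hmono : MonotoneOn d (Set.Ici N)) : ∃ C, ∀ ⦃n m⦄, n ≤ m → d n ≤ C * d m := by
  have hsups : ∀ n, d n ≤ partialSups d n := le_partialSups d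
  have hbigO : partialSups d =O[atTop] d := by
    refine .of_bound (partialSups d N / d N) (eventually_atTop.2 ⟨N, fun n hn => ?_⟩)
    rw [Real.norm_of_nonneg ((hd n).le.trans (hsups n)), Real.norm_of_nonneg (hd n).le]
    have hone : 1 ≤ partialSups d N / d N := (one_le_div (hd N)).2 (hsups N)
    refine partialSups_le _ _ _ fun k hk => ?_
    rcases le_total k N with hkN | hNk
    · calc d k ≤ partialSups d N / d N * d N := by
            rw [div_mul_cancel₀ _ (hd N).ne']; exact le_partialSups_of_le d hkN
        _ ≤ partialSups d N / d N * d n := by gcongr; exact hmono Set.self_mem_Ici hn hn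
    · exact (hmono hNk hn hk).trans (le_mul_of_one_le_left (hd n).le hone)
  obtain ⟨C, -, hC⟩ := Asymptotics.bound_of_isBigO_nat_atTop hbigO
  refine ⟨C, fun n m hnm => (le_partialSups_of_le d hnm).trans ((le_abs_self _).trans ?_)⟩
  simpa only [Real.norm_eq_abs, abs_of_pos (hd m)] using hC (hd m).ne'

theorem exists_pow_mul_le_of_eventually_mul_le_succ {c : ℕ → ℝ} (hc : ∀ n, 0 < c n) {ρ : ℝ}
    (hρ : 0 < ρ) (h : ∀ᶠ n in atTop, ρ * c n ≤ c (n + 1)) :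
    ∃ C, ∀ n j, ρ ^ j * c n ≤ C * c (n + j) := by
  obtain ⟨N, hN⟩ := eventually_atTop.1 h
  have hmono : MonotoneOn (fun n => c n / ρ ^ n) (Set.Ici N) := by
    refine monotoneOn_nat_Ici_of_le_succ fun n hn => ?_
    rw [div_le_div_iff₀ (by positivity) (by positivity), pow_succ']
    calc c n * (ρ * ρ ^ n) = ρ * c n * ρ ^ n := by ring
      _ ≤ c (n + 1) * ρ ^ n := by gcongr; exact hN n hn
  obtain ⟨C, hC⟩ := exists_forall_le_mul_of_monotoneOn
    (fun n => div_pos (hc n) (pow_pos hρ n)) hmono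
  refine ⟨C, fun n j => ?_⟩
  have hle := hC (Nat.le_add_right n j)
  rw [pow_add, ← mul_div_assoc, div_le_div_iff₀ (by positivity) (by positivity)] at hle
  refine le_of_mul_le_mul_right ?_ (pow_pos hρ n)
  linarith

end CesaroNumbers

section CesaroSeries

open PowerSeries

/-- The formal power series of `(1 - r t)^(-s)` in the variable `t`. Keeping `r` as a parameter
makes `cesaroSeries r s`, `r < 1`, a regularisation of `cesaroSeries 1 s` with geometrically
decaying coefficients. -/
noncomputable def cesaroSeries (r s : ℝ) : ℝ⟦X⟧ :=
  mk fun n => r ^ n * cesaroNumber s n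

@[simp]
theorem coeff_cesaroSeries (r s : ℝ) (n : ℕ) :
    coeff n (cesaroSeries r s) = r ^ n * cesaroNumber s n :=
  coeff_mk _ _

theorem cesaroSeries_eq_rescale_binomialSeries (r s : ℝ) :
    cesaroSeries r s = rescale (-r) (binomialSeries ℝ (-s)) := by
  ext n
  rw [coeff_cesaroSeries, coeff_rescale, binomialSeries_coeff, ← neg_neg s,
    cesaroNumber_neg_eq_choose, neg_neg, neg_pow r, smul_eq_mul]
  ring

theorem cesaroSeries_add (r s t : ℝ) :
    cesaroSeries r (s + t) = cesaroSeries r s * cesaroSeries r t := by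
  simp only [cesaroSeries_eq_rescale_binomialSeries, neg_add, binomialSeries_add, map_mul]

theorem cesaroSeries_zero_left (s : ℝ) : cesaroSeries 0 s = 1 := by
  ext n
  cases n <;> simp [coeff_one]

theorem cesaroSeries_neg_one_right (r : ℝ) : cesaroSeries r (-1) = 1 - C r * X := by
  have h := binomialSeries_nat (R := ℝ) (A := ℝ) 1
  rw [Nat.cast_one, pow_one] at h
  rw [cesaroSeries_eq_rescale_binomialSeries, neg_neg, h, map_add, map_one, rescale_X, map_neg,
    neg_mul, sub_eq_add_neg]

theorem derivative_cesaroSeries (r s : ℝ) :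
    derivative (R := ℝ) (cesaroSeries r s) = (s * r) • cesaroSeries r (s + 1) := by
  ext n
  rw [coeff_derivative, coeff_smul, coeff_cesaroSeries, coeff_cesaroSeries, smul_eq_mul]
  linear_combination r ^ (n + 1) * succ_mul_cesaroNumber_succ_eq_mul_add_one s n

theorem coeff_cesaroSeries_one_mul_cesaroSeries_one (p q : ℝ) (n : ℕ) :
    coeff n (cesaroSeries 1 p * cesaroSeries 1 q) = cesaroNumber (p + q) n := by
  rw [← cesaroSeries_add, coeff_cesaroSeries, one_pow, one_mul]

theorem coeff_zero_cesaroSeries_mul_cesaroSeries (r r' p q : ℝ) :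
    coeff 0 (cesaroSeries r p * cesaroSeries r' q) = 1 := by
  simp [coeff_mul]

theorem succ_mul_coeff_succ_cesaroSeries_mul_cesaroSeries (r p q : ℝ) (n : ℕ) :
    (n + 1) * coeff (n + 1) (cesaroSeries 1 p * cesaroSeries r q) =
      p * coeff n (cesaroSeries 1 (p + 1) * cesaroSeries r q) +
        q * r * coeff n (cesaroSeries 1 p * cesaroSeries r (q + 1)) := by
  rw [mul_comm, ← coeff_derivative, Derivation.leibniz, derivative_cesaroSeries,
    derivative_cesaroSeries]
  simp only [smul_eq_mul, mul_smul_comm, map_add, coeff_smul, mul_one,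
    mul_comm (cesaroSeries r q), smul_mul_assoc]
  ring

theorem succ_mul_abs_coeff_succ_cesaroSeries_mul_cesaroSeries_le (p : ℝ) {q r : ℝ}
    (hq : 0 ≤ q) (hr : r ∈ Set.Icc 0 1) (n : ℕ) :
    (n + 1) * |coeff (n + 1) (cesaroSeries 1 p * cesaroSeries r q)| ≤
      |p| * |coeff n (cesaroSeries 1 (p + 1) * cesaroSeries r q)| +
        q * |coeff n (cesaroSeries 1 p * cesaroSeries r (q + 1))| := by
  have hn : (0 : ℝ) < n + 1 := by positivity
  nth_rw 1 [← abs_of_pos hn]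
  rw [← abs_mul, succ_mul_coeff_succ_cesaroSeries_mul_cesaroSeries]
  refine (abs_add_le _ _).trans ?_
  rw [abs_mul, abs_mul, abs_mul, abs_of_nonneg hq, abs_of_nonneg hr.1]
  gcongr
  exact mul_le_of_le_one_right hq hr.2

theorem abs_coeff_le_cesaroNumber_of_nonneg {p q r : ℝ} (hp : 0 ≤ p) (hq : 0 ≤ q)
    (hr : r ∈ Set.Icc 0 1) (n : ℕ) :
    |coeff n (cesaroSeries 1 p * cesaroSeries r q)| ≤ cesaroNumber (p + q) n := by
  have hp' := cesaroNumber_nonneg hp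
  have hq' := cesaroNumber_nonneg hq
  have hr0 : 0 ≤ r := hr.1
  rw [← coeff_cesaroSeries_one_mul_cesaroSeries_one, coeff_mul, coeff_mul]
  simp only [coeff_cesaroSeries, one_pow, one_mul]
  rw [abs_of_nonneg (Finset.sum_nonneg fun i _ => by have := hp' i.1; have := hq' i.2; positivity)]
  gcongr with i
  · exact hp' _
  · exact mul_le_of_le_one_left (hq' _) (pow_le_one₀ hr.1 hr.2)

theorem coeff_succ_cesaroSeries_neg_one_mul_cesaroSeries_one (r : ℝ) (n : ℕ) :
    coeff (n + 1) (cesaroSeries 1 (-1) * cesaroSeries r 1) = -((1 - r) * r ^ n) := by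
  rw [cesaroSeries_neg_one_right, map_one, one_mul, sub_mul, one_mul, map_sub,
    coeff_succ_X_mul]
  simp only [coeff_cesaroSeries, cesaroNumber_one_left]
  ring

theorem sum_abs_coeff_cesaroSeries_neg_one_mul_cesaroSeries_one_le {r : ℝ}
    (hr : r ∈ Set.Icc 0 1) (n : ℕ) :
    ∑ j ∈ Finset.range (n + 1), |coeff j (cesaroSeries 1 (-1) * cesaroSeries r 1)| ≤ 2 := by
  have habs : ∀ j, |-((1 - r) * r ^ j)| = (1 - r) * r ^ j := fun j => by
    rw [abs_neg, abs_of_nonneg (mul_nonneg (sub_nonneg.2 hr.2) (pow_nonneg hr.1 j))]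
  rw [Finset.sum_range_succ', coeff_zero_cesaroSeries_mul_cesaroSeries, abs_one]
  simp only [coeff_succ_cesaroSeries_neg_one_mul_cesaroSeries_one, habs]
  rw [← Finset.mul_sum, mul_neg_geom_sum]
  linarith [pow_nonneg hr.1 n]

theorem abs_coeff_mul_le_of_monotone {f g : ℝ⟦X⟧} {B : ℕ → ℝ} {M : ℝ} (hB : Monotone B)
    (hf : ∀ n, |coeff n f| ≤ B n) (hg : ∀ n, ∑ j ∈ Finset.range (n + 1), |coeff j g| ≤ M) (n : ℕ) :
    |coeff n (f * g)| ≤ M * B n := by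
  have hBn : 0 ≤ B n := (abs_nonneg _).trans (hf n)
  rw [mul_comm f, coeff_mul, Finset.Nat.sum_antidiagonal_eq_sum_range_succ
    (fun i j => coeff i g * coeff j f)]
  calc |∑ j ∈ Finset.range (n + 1), coeff j g * coeff (n - j) f|
      ≤ ∑ j ∈ Finset.range (n + 1), |coeff j g * coeff (n - j) f| := Finset.abs_sum_le_sum_abs _ _
    _ ≤ ∑ j ∈ Finset.range (n + 1), |coeff j g| * B n := by
        gcongr with j
        rw [abs_mul]
        gcongr
        exact (hf _).trans (hB (Nat.sub_le n j))
    _ ≤ M * B n := by rw [← Finset.sum_mul]; gcongr; exact hg n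

theorem abs_coeff_le_two_pow_mul_cesaroNumber {p q r : ℝ} (k : ℕ) (hp : -k ≤ p) (hq : 0 ≤ q)
    (hpq : 1 ≤ p + q) (hr : r ∈ Set.Icc 0 1) (n : ℕ) :
    |coeff n (cesaroSeries 1 p * cesaroSeries r q)| ≤ 2 ^ k * cesaroNumber (p + q) n := by
  induction k generalizing p q n with
  | zero => simpa using abs_coeff_le_cesaroNumber_of_nonneg (by simpa using hp) hq hr n
  | succ k ih =>
    rcases le_or_gt 0 p with hp0 | hp0
    · refine (abs_coeff_le_cesaroNumber_of_nonneg hp0 hq hr n).trans ?_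
      exact le_mul_of_one_le_left (cesaroNumber_nonneg (by linarith) n) (one_le_pow₀ one_le_two)
    · push_cast at hp
      have hfactor : cesaroSeries 1 p * cesaroSeries r q =
          (cesaroSeries 1 (p + 1) * cesaroSeries r (q - 1)) *
            (cesaroSeries 1 (-1) * cesaroSeries r 1) := by
        rw [mul_mul_mul_comm, ← cesaroSeries_add, ← cesaroSeries_add, add_neg_cancel_right,
          sub_add_cancel]
      have hsum : p + 1 + (q - 1) = p + q := by ring
      have hih := ih (p := p + 1) (q := q - 1) (by linarith) (by linarith) (by linarith)
      rw [hsum] at hih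
      rw [hfactor, pow_succ', mul_assoc 2]
      exact abs_coeff_mul_le_of_monotone ((monotone_cesaroNumber hpq).const_mul (by positivity))
        hih (sum_abs_coeff_cesaroSeries_neg_one_mul_cesaroSeries_one_le hr) n

/-- The coefficients of the regularisation `(1 - t)^(-p) (1 - r t)^(-q)` of `(1 - t)^(-(p + q))`
are dominated, uniformly in `r`, by those of its limit at `r = 1`. -/
def UniformlyDominated (p q : ℝ) : Prop :=
  ∃ C, ∀ r ∈ Set.Icc (0 : ℝ) 1, ∀ n,
    |coeff n (cesaroSeries 1 p * cesaroSeries r q)| ≤ C * |cesaroNumber (p + q) n|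

theorem UniformlyDominated.of_add_one {p q : ℝ} (hq : 0 ≤ q) (hpq : p + q ≠ 0)
    (hp₁ : UniformlyDominated (p + 1) q) (hq₁ : UniformlyDominated p (q + 1)) :
    UniformlyDominated p q := by
  obtain ⟨C₁, hC₁⟩ := hp₁
  obtain ⟨C₂, hC₂⟩ := hq₁
  rw [add_right_comm] at hC₁
  rw [← add_assoc] at hC₂
  set D := |p| * C₁ + q * C₂
  refine ⟨max 1 (D / |p + q|), fun r hr n => ?_⟩
  cases n with
  | zero => simp [coeff_zero_cesaroSeries_mul_cesaroSeries]
  | succ n =>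
    have hn : (0 : ℝ) < n + 1 := by positivity
    have hderiv : (n + 1) * |coeff (n + 1) (cesaroSeries 1 p * cesaroSeries r q)| ≤
        D * |cesaroNumber (p + q + 1) n| := by
      refine (succ_mul_abs_coeff_succ_cesaroSeries_mul_cesaroSeries_le p hq hr n).trans ?_
      rw [add_mul, mul_assoc, mul_assoc]
      gcongr |p| * ?_ + q * ?_
      · exact hC₁ r hr n
      · exact hC₂ r hr n
    have hshift : (n + 1) * |cesaroNumber (p + q) (n + 1)| =
        |p + q| * |cesaroNumber (p + q + 1) n| := by
      rw [← abs_mul, ← succ_mul_cesaroNumber_succ_eq_mul_add_one, abs_mul, abs_of_pos hn]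
    refine le_trans ?_ (mul_le_mul_of_nonneg_right (le_max_right _ _) (abs_nonneg _))
    refine le_of_mul_le_mul_left (hderiv.trans_eq ?_) hn
    rw [mul_left_comm, hshift]
    field_simp

theorem uniformlyDominated_of_one_sub_le (m : ℕ) {p q : ℝ} (hq : 0 ≤ q)
    (hpq : ∀ i : ℕ, p + q ≠ -i) (hm : 1 - m ≤ p + q) : UniformlyDominated p q := by
  induction m generalizing p q with
  | zero =>
    rw [Nat.cast_zero, sub_zero] at hm
    refine ⟨2 ^ ⌈-p⌉₊, fun r hr n => ?_⟩
    rw [abs_of_nonneg (cesaroNumber_nonneg (by linarith) n)]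
    exact abs_coeff_le_two_pow_mul_cesaroNumber _ (by linarith [Nat.le_ceil (-p)]) hq hm hr n
  | succ m ih =>
    push_cast at hm
    have hpq₁ : ∀ i : ℕ, p + q + 1 ≠ -i := fun i hi => hpq (i + 1) (by push_cast; linarith)
    refine .of_add_one hq (by simpa using hpq 0) (ih hq ?_ (by linarith))
      (ih (by linarith) ?_ (by linarith))
    · rwa [add_right_comm]
    · rwa [← add_assoc]

theorem uniformlyDominated {p q : ℝ} (hq : 0 ≤ q) (hpq : ∀ i : ℕ, p + q ≠ -i) :
    UniformlyDominated p q :=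
  uniformlyDominated_of_one_sub_le ⌈1 - (p + q)⌉₊ hq hpq (by linarith [Nat.le_ceil (1 - (p + q))])

theorem exists_abs_cesaroNumber_le_mul_abs_cesaroNumber_add {p q : ℝ} (hq : 0 ≤ q)
    (hpq : ∀ i : ℕ, p + q ≠ -i) :
    ∃ C, ∀ n, |cesaroNumber p n| ≤ C * |cesaroNumber (p + q) n| := by
  obtain ⟨C, hC⟩ := uniformlyDominated hq hpq
  refine ⟨C, fun n => ?_⟩
  simpa [cesaroSeries_zero_left] using hC 0 (by simp) n

end CesaroSeries

section FractionalDifferences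

open PowerSeries

theorem tsum_coeff_mul_mul_eq_tsum_mul_tsum_shift {𝕜 : Type*} [NormedField 𝕜] [CompleteSpace 𝕜]
    {f g : 𝕜⟦X⟧} {u : ℕ → 𝕜}
    (h : Summable fun x : ℕ × ℕ => coeff x.1 g * (coeff x.2 f * u (x.2 + x.1))) :
    ∑' n, coeff n (f * g) * u n = ∑' j, coeff j g * ∑' n, coeff n f * u (n + j) := by
  let e := Finset.HasAntidiagonal.sigmaAntidiagonalEquivProd (A := ℕ)
  have hfiber : ∀ n, coeff n (f * g) * u n =
      ∑' y : Finset.HasAntidiagonal.antidiagonal n,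
        coeff y.1.1 g * (coeff y.1.2 f * u (y.1.2 + y.1.1)) := by
    intro n
    rw [tsum_fintype, Finset.univ_eq_attach, mul_comm f, coeff_mul, Finset.sum_mul,
      ← Finset.sum_attach]
    refine Finset.sum_congr rfl fun y _ => ?_
    rw [add_comm y.1.2, Finset.HasAntidiagonal.mem_antidiagonal.1 y.2, mul_assoc]
  calc ∑' n, coeff n (f * g) * u n
      = ∑' x : ℕ × ℕ, coeff x.1 g * (coeff x.2 f * u (x.2 + x.1)) := by
        simp_rw [hfiber]
        rw [← e.tsum_eq]
        exact (Summable.tsum_sigma' (fun _ => (hasSum_fintype _).summable)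
          (e.summable_iff.2 h)).symm
    _ = ∑' j, coeff j g * ∑' n, coeff n f * u (n + j) := by
        rw [h.tsum_prod]
        simp_rw [tsum_mul_left]

theorem exists_pow_mul_abs_cesaroNumber_le_mul_abs_cesaroNumber_add_shift {p q ρ : ℝ}
    (hq : 0 ≤ q) (hpq : ∀ i : ℕ, p + q ≠ -i) (hρ₀ : 0 < ρ) (hρ₁ : ρ < 1) :
    ∃ C, ∀ n j, ρ ^ j * |cesaroNumber p n| ≤ C * |cesaroNumber (p + q) (n + j)| := by
  obtain ⟨D, hD⟩ := exists_abs_cesaroNumber_le_mul_abs_cesaroNumber_add hq hpq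
  have hD0 : 0 ≤ D := by simpa using (abs_nonneg _).trans (hD 0)
  obtain ⟨C, hC⟩ := exists_pow_mul_le_of_eventually_mul_le_succ
    (fun n => abs_pos.2 (cesaroNumber_ne_zero hpq n)) hρ₀
    (eventually_mul_abs_cesaroNumber_le_succ (p + q) hρ₁)
  refine ⟨D * C, fun n j => ?_⟩
  calc ρ ^ j * |cesaroNumber p n|
      ≤ ρ ^ j * (D * |cesaroNumber (p + q) n|) := by gcongr; exact hD n
    _ = D * (ρ ^ j * |cesaroNumber (p + q) n|) := mul_left_comm _ _ _
    _ ≤ D * (C * |cesaroNumber (p + q) (n + j)|) := by gcongr ?_ * ?_; exact hC n j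
    _ = D * C * |cesaroNumber (p + q) (n + j)| := (mul_assoc _ _ _).symm

theorem summable_coeff_cesaroSeries_mul_shift {p q r : ℝ} {u : ℕ → ℝ} (hq : 0 ≤ q)
    (hpq : ∀ i : ℕ, p + q ≠ -i) (hu : ∀ n, 0 ≤ u n)
    (hsum : Summable fun n => |cesaroNumber (p + q) n| * u n) (hr : r ∈ Set.Ico 0 1) :
    Summable fun x : ℕ × ℕ =>
      coeff x.1 (cesaroSeries r q) * (coeff x.2 (cesaroSeries 1 p) * u (x.2 + x.1)) := by
  obtain ⟨ρ, hrρ, hρ₁⟩ := exists_between hr.2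
  have hr₀ : 0 ≤ r := hr.1
  have hρ₀ : 0 < ρ := hr₀.trans_lt hrρ
  obtain ⟨C, hC⟩ :=
    exists_pow_mul_abs_cesaroNumber_le_mul_abs_cesaroNumber_add_shift hq hpq hρ₀ hρ₁
  have hratio : |r / ρ| < 1 := by
    rw [abs_of_nonneg (by positivity)]
    exact (div_lt_one hρ₀).2 hrρ
  have hprod := ((summable_cesaroNumber_mul_pow q hratio).mul_of_nonneg hsum
    (fun j => mul_nonneg (cesaroNumber_nonneg hq j) (by positivity))
    (fun n => mul_nonneg (abs_nonneg _) (hu n))).mul_left C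
  have hinj : Function.Injective fun x : ℕ × ℕ => (x.1, x.2 + x.1) := by
    rintro ⟨j, n⟩ ⟨j', n'⟩ h
    simp only [Prod.mk.injEq] at h ⊢
    omega
  refine Summable.of_norm_bounded (hprod.comp_injective hinj) ?_
  rintro ⟨j, n⟩
  have hqj := cesaroNumber_nonneg hq j
  have hun := hu (n + j)
  simp only [coeff_cesaroSeries, one_pow, one_mul, Function.comp_apply, norm_mul, norm_pow,
    Real.norm_eq_abs, abs_of_nonneg hr₀, abs_of_nonneg hqj, abs_of_nonneg hun]
  calc r ^ j * cesaroNumber q j * (|cesaroNumber p n| * u (n + j))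
      = cesaroNumber q j * (r / ρ) ^ j * u (n + j) * (ρ ^ j * |cesaroNumber p n|) := by
        rw [div_pow]; field_simp
    _ ≤ cesaroNumber q j * (r / ρ) ^ j * u (n + j) *
          (C * |cesaroNumber (p + q) (n + j)|) := by
        gcongr ?_ * ?_; exact hC n j
    _ = C * (cesaroNumber q j * (r / ρ) ^ j * (|cesaroNumber (p + q) (n + j)| * u (n + j))) := by
        ring

theorem tsum_coeff_cesaroSeries_mul_nonneg {p q r : ℝ} {u : ℕ → ℝ} (hq : 0 ≤ q)
    (hpq : ∀ i : ℕ, p + q ≠ -i) (hu : ∀ n, 0 ≤ u n)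
    (hsum : Summable fun n => |cesaroNumber (p + q) n| * u n)
    (hp : ∀ j, 0 ≤ ∑' n, cesaroNumber p n * u (n + j)) (hr : r ∈ Set.Ico 0 1) :
    0 ≤ ∑' n, coeff n (cesaroSeries 1 p * cesaroSeries r q) * u n := by
  rw [tsum_coeff_mul_mul_eq_tsum_mul_tsum_shift
    (summable_coeff_cesaroSeries_mul_shift hq hpq hu hsum hr)]
  simp only [coeff_cesaroSeries, one_pow, one_mul]
  exact tsum_nonneg fun j =>
    mul_nonneg (mul_nonneg (pow_nonneg hr.1 j) (cesaroNumber_nonneg hq j)) (hp j)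

theorem tendsto_tsum_coeff_cesaroSeries_mul {p q : ℝ} {u : ℕ → ℝ} (hdom : UniformlyDominated p q)
    (hsum : Summable fun n => |cesaroNumber (p + q) n| * |u n|) :
    Tendsto (fun r => ∑' n, coeff n (cesaroSeries 1 p * cesaroSeries r q) * u n) (𝓝[<] 1)
      (𝓝 (∑' n, cesaroNumber (p + q) n * u n)) := by
  obtain ⟨C, hC⟩ := hdom
  refine tendsto_tsum_of_dominated_convergence (hsum.mul_left C) (fun n => ?_) ?_
  · rw [← coeff_cesaroSeries_one_mul_cesaroSeries_one]
    have hcont : Continuous fun r => coeff n (cesaroSeries 1 p * cesaroSeries r q) := by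
      simp only [coeff_mul, coeff_cesaroSeries]
      fun_prop
    exact ((hcont.tendsto 1).mono_left nhdsWithin_le_nhds).mul_const _
  · filter_upwards [Ico_mem_nhdsLT one_pos] with r hr n
    rw [norm_mul, ← mul_assoc]
    exact mul_le_mul_of_nonneg_right (hC r (Set.Ico_subset_Icc_self hr) n) (norm_nonneg _)

theorem tsum_cesaroNumber_add_mul_nonneg {p q : ℝ} {u : ℕ → ℝ} (hq : 0 ≤ q)
    (hpq : ∀ i : ℕ, p + q ≠ -i) (hu : ∀ n, 0 ≤ u n)
    (hsum : Summable fun n => |cesaroNumber (p + q) n| * u n)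
    (hp : ∀ j, 0 ≤ ∑' n, cesaroNumber p n * u (n + j)) :
    0 ≤ ∑' n, cesaroNumber (p + q) n * u n := by
  refine ge_of_tendsto (tendsto_tsum_coeff_cesaroSeries_mul (uniformlyDominated hq hpq) ?_) ?_
  · simpa only [abs_of_nonneg (hu _)] using hsum
  · filter_upwards [Ico_mem_nhdsLT one_pos] with r hr
    exact tsum_coeff_cesaroSeries_mul_nonneg hq hpq hu hsum hp hr

end FractionalDifferences

section HereditarySums

variable {H : Type*} [NormedAddCommGroup H] [InnerProductSpace ℂ H] [CompleteSpace H]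
  {α β : ℕ → ℝ} {T R S : H →L[ℂ] H}

theorem hasHereditarySum_iff_forall_tendsto :
    HasHereditarySum α T S ↔
      ∀ x, Tendsto (fun N => hereditaryPartialSum α T N x) atTop (𝓝 (S x)) :=
  PointwiseConvergenceCLM.tendsto_iff_forall_tendsto

theorem HasHereditarySum.add (hα : HasHereditarySum α T R) (hβ : HasHereditarySum β T S) :
    HasHereditarySum (fun n => α n + β n) T (R + S) := by
  rw [hasHereditarySum_iff_forall_tendsto] at *
  refine fun x => ((hα x).add (hβ x)).congr fun N => ?_
  simp [hereditaryPartialSum, add_smul, Finset.sum_add_distrib]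

theorem HasHereditarySum.const_mul (c : ℝ) (hα : HasHereditarySum α T S) :
    HasHereditarySum (fun n => c * α n) T ((c : ℂ) • S) := by
  rw [hasHereditarySum_iff_forall_tendsto] at *
  refine fun x => ((hα x).const_smul (c : ℂ)).congr fun N => ?_
  simp [hereditaryPartialSum, mul_smul, Finset.smul_sum]

theorem exists_hasHereditarySum_of_eventually_eq_zero (hα : ∀ᶠ n in atTop, α n = 0) :
    ∃ S, HasHereditarySum α T S := by
  obtain ⟨N, hN⟩ := eventually_atTop.1 hα
  refine ⟨hereditaryPartialSum α T N, tendsto_atTop_of_eventually_const (i₀ := N) fun M hM => ?_⟩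
  have hsum : hereditaryPartialSum α T M = hereditaryPartialSum α T N :=
    Finset.eventually_constant_sum (fun n hn => by simp [hN n hn]) hM
  rw [hsum]

theorem AbsHereditarySummable.exists_hasHereditarySum {σ : ℝ} (h : AbsHereditarySummable α T)
    (hσ : ∀ᶠ n in atTop, α n = σ * |α n|) : ∃ S, HasHereditarySum α T S := by
  obtain ⟨S, hS⟩ := h
  obtain ⟨R, hR⟩ := exists_hasHereditarySum_of_eventually_eq_zero (T := T)
    (hσ.mono fun n hn => sub_eq_zero.2 hn)
  exact ⟨_, by simpa using hR.add (hS.const_mul σ)⟩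

theorem inner_adjoint_pow_mul_pow_apply_self (T : H →L[ℂ] H) (n : ℕ) (x : H) :
    inner ℂ ((ContinuousLinearMap.adjoint T ^ n * T ^ n) x) x = ((‖(T ^ n) x‖ ^ 2 : ℝ) : ℂ) := by
  rw [← ContinuousLinearMap.star_eq_adjoint, ← star_pow, ContinuousLinearMap.star_eq_adjoint,
    mul_apply_eq_comp, ContinuousLinearMap.adjoint_inner_left,
    inner_self_eq_norm_sq_to_K, Complex.ofReal_pow]
  rfl

theorem inner_hereditaryPartialSum_apply_self (α : ℕ → ℝ) (T : H →L[ℂ] H) (N : ℕ) (x : H) :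
    inner ℂ (hereditaryPartialSum α T N x) x =
      ((∑ n ∈ Finset.range N, α n * ‖(T ^ n) x‖ ^ 2 : ℝ) : ℂ) := by
  simp only [hereditaryPartialSum, sum_apply, sum_inner, smul_apply, inner_smul_left,
    inner_adjoint_pow_mul_pow_apply_self, Complex.conj_ofReal, Complex.ofReal_sum,
    Complex.ofReal_mul]

theorem HasHereditarySum.tendsto_sum_mul_norm_sq (h : HasHereditarySum α T S) (x : H) :
    Tendsto (fun N => ((∑ n ∈ Finset.range N, α n * ‖(T ^ n) x‖ ^ 2 : ℝ) : ℂ)) atTop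
      (𝓝 (inner ℂ (S x) x)) := by
  simp_rw [← inner_hereditaryPartialSum_apply_self]
  exact (hasHereditarySum_iff_forall_tendsto.1 h x).inner tendsto_const_nhds

theorem HasHereditarySum.inner_eq_tsum (h : HasHereditarySum α T S) (x : H)
    (hs : Summable fun n => α n * ‖(T ^ n) x‖ ^ 2) :
    inner ℂ (S x) x = ((∑' n, α n * ‖(T ^ n) x‖ ^ 2 : ℝ) : ℂ) :=
  tendsto_nhds_unique (h.tendsto_sum_mul_norm_sq x)
    ((Complex.continuous_ofReal.tendsto _).comp hs.hasSum.tendsto_sum_nat)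

theorem AbsHereditarySummable.summable_abs_mul_norm_sq (h : AbsHereditarySummable α T) (x : H) :
    Summable fun n => |α n| * ‖(T ^ n) x‖ ^ 2 := by
  obtain ⟨S, hS⟩ := h
  have hre := (Complex.continuous_re.tendsto _).comp (hS.tendsto_sum_mul_norm_sq x)
  simp only [Function.comp_def, Complex.ofReal_re] at hre
  exact ((hasSum_iff_tendsto_nat_of_nonneg (fun n => by positivity) _).2 hre).summable

theorem AbsHereditarySummable.summable_mul_norm_sq_of_abs_le {C : ℝ}
    (h : AbsHereditarySummable α T) (hβ : ∀ n, |β n| ≤ C * |α n|) (x : H) :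
    Summable fun n => β n * ‖(T ^ n) x‖ ^ 2 := by
  refine .of_norm_bounded ((h.summable_abs_mul_norm_sq x).mul_left C) fun n => ?_
  rw [norm_mul, Real.norm_eq_abs, norm_pow, norm_norm, ← mul_assoc]
  gcongr
  exact hβ n

theorem HasHereditarySum.isPositive_iff (h : HasHereditarySum α T S)
    (hs : ∀ x, Summable fun n => α n * ‖(T ^ n) x‖ ^ 2) :
    S.IsPositive ↔ ∀ x, 0 ≤ ∑' n, α n * ‖(T ^ n) x‖ ^ 2 := by
  simp only [ContinuousLinearMap.isPositive_iff_complex, h.inner_eq_tsum _ (hs _)]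
  simp

end HereditarySums

theorem theorem1p5_general {H : Type*} [NormedAddCommGroup H] [InnerProductSpace ℂ H]
    [CompleteSpace H] {a b : ℝ} (hba : b ≤ a) (hb : ∀ m : ℕ, b ≠ m) {T : H →L[ℂ] H}
    (hT : IsRealContraction a T) (hTb : AbsHereditarySummable (cesaroNumber (-b)) T) :
    IsRealContraction b T := by
  obtain ⟨S, hS, hSpos⟩ := hT
  obtain ⟨σ, hσ⟩ := exists_eventually_cesaroNumber_eq_mul_abs (-b)
  obtain ⟨R, hR⟩ := hTb.exists_hasHereditarySum hσ
  have hab : -a + (a - b) = -b := by ring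
  have hq : 0 ≤ a - b := sub_nonneg.2 hba
  have hpq : ∀ m : ℕ, -a + (a - b) ≠ -m := fun m => by simpa only [hab, ne_eq, neg_inj] using hb m
  obtain ⟨C, hC⟩ := exists_abs_cesaroNumber_le_mul_abs_cesaroNumber_add hq hpq
  rw [hab] at hC
  refine ⟨R, hR, (hR.isPositive_iff
    (hTb.summable_mul_norm_sq_of_abs_le fun n => (one_mul _).ge)).2 fun x => ?_⟩
  have hshift : ∀ j, 0 ≤ ∑' n, cesaroNumber (-a) n * ‖(T ^ (n + j)) x‖ ^ 2 := fun j => by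
    simpa only [pow_add, mul_apply_eq_comp] using
      (hS.isPositive_iff (hTb.summable_mul_norm_sq_of_abs_le hC)).1 hSpos ((T ^ j) x)
  have hsum := hTb.summable_abs_mul_norm_sq x
  rw [← hab] at hsum ⊢
  exact tsum_cesaroNumber_add_mul_nonneg hq hpq (fun n => by positivity) hsum hshift

theorem theorem1p5 {H : Type*} [NormedAddCommGroup H] [InnerProductSpace ℂ H] [CompleteSpace H]
    (a b : ℝ) (hb : 0 < b) (hba : b < a) (hbint : ∀ m : ℤ, b ≠ (m : ℝ))
    (T : H →L[ℂ] H) (hT : IsRealContraction a T)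
    (hTb : AbsHereditarySummable (cesaroNumber (-b)) T) :
    IsRealContraction b T :=
  theorem1p5_general hba.le (fun m => by exact_mod_cast hbint m) hT hTb
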